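/- Let $K$ be a field of characteristic zero, let $R$ be a commutative Noetherian $K$-algebra which is an integral domain, and let $\delta : R \to R$ be a derivation (an additive map with $\delta(ab) = \delta(a)b + a\delta(b)$; it need not be $K$-linear). Assume that $R$ is $\delta$-simple, that is, $0$ and $R$ are the only ideals $I$ of $R$ with $\delta(I) \subseteq I$. Let $S = R[\theta;\delta]$ be the differential operator ring: the free left $R$-module with basis $1, \theta, \theta^2, \ldots$, with the multiplication that extends that of $R$ and satisfies $\theta a = a\theta + \delta(a)$ for $a \in R$. Suppose that $x \in R$ satisfies the following two conditions: 1. there is a non-maximal prime ideal $P$ of $R$ with $x \in P$; 2. $\delta(x)$ is invertible in $R$, or $x$ is a prime element of $R$. Then the left $S$-module $S/S\theta x$ is an essential extension of its submodule $Sx/S\theta x$, the module $Sx/S\theta x$ is simple, and $S/S\theta x$ is not Artinian. In particular, $S$ does not satisfy the property $(\diamond)$ that every cyclic left $S$-module which is an essential extension of a simple submodule is Artinian. -/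

import Mathlib

universe u

/-- `R` is `δ`-simple: its only ideals `I` with `δ(I) ⊆ I` are `0` and `R`. -/
def IsDeltaSimple {R : Type*} [CommRing R] (δ : Derivation ℤ R R) : Prop :=
  ∀ I : Ideal R, (∀ a ∈ I, δ a ∈ I) → I = ⊥ ∨ I = ⊤

/-- The module `M` is an essential extension of its submodule `N`: every non-zero submodule of
`M` meets `N` non-trivially. -/
def IsEssentialExtension {S M : Type*} [Ring S] [AddCommGroup M] [Module S M]
    (N : Submodule S M) : Prop :=
  ∀ U : Submodule S M, U ≠ ⊥ → U ⊓ N ≠ ⊥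

/-- Property `(⋄)` of a (Noetherian) ring `S`: every cyclic left `S`-module that is an essential
extension of a simple submodule is Artinian. A cyclic module is a quotient of `S`, so the modules
in the universe of `S` are all that matter. -/
def SatisfiesDiamond (S : Type u) [Ring S] : Prop :=
  ∀ (M : Type u) [AddCommGroup M] [Module S M] (N : Submodule S M),
    (∃ m : M, Submodule.span S {m} = ⊤) → IsSimpleModule S N → IsEssentialExtension N →
      IsArtinian S M

/-- The underlying type of the differential operator ring `R[θ; δ]`: formal expressions
`∑ aᵢ θⁱ`, with the coefficients `aᵢ ∈ R` on the left. Only the additive structure of `R[X]` is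
kept; multiplication is defined below. -/
def DiffOpRing {R : Type u} [CommRing R] (_δ : Derivation ℤ R R) : Type u :=
  Polynomial R

namespace DiffOpRing

open Polynomial

noncomputable section

variable {R : Type u} [CommRing R] (δ : Derivation ℤ R R)

instance : AddCommGroup (DiffOpRing δ) :=
  inferInstanceAs (AddCommGroup R[X])

/-- `∑ aᵢ θⁱ ↦ ∑ δ(aᵢ) θⁱ`. -/
def coeffDer : R[X] →+ R[X] where
  toFun p := p.sum fun i a => monomial i (δ a)
  map_zero' := by simp
  map_add' p q := by
    rw [Polynomial.sum_add_index p q] <;> simp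

/-- Left multiplication by `θ`: since `θ a = a θ + δ(a)`,
`θ · ∑ aᵢ θⁱ = ∑ aᵢ θⁱ⁺¹ + ∑ δ(aᵢ) θⁱ`. -/
def thetaMul : R[X] →+ R[X] :=
  AddMonoidHom.mulLeft X + coeffDer δ

/-- The product of `f = ∑ aᵢ θⁱ` and `g`: apply `i` times left multiplication by `θ` to `g`,
multiply the coefficients by `aᵢ` on the left, and sum over `i`. -/
def mulAux (f g : R[X]) : R[X] :=
  f.sum fun i a => C a * (thetaMul δ)^[i] g

theorem mulAux_monomial (i : ℕ) (a : R) (p : R[X]) :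
    mulAux δ (monomial i a) p = C a * (thetaMul δ)^[i] p := by
  rw [mulAux, Polynomial.sum_monomial_index _ _ (by simp)]

theorem mulAux_add_left (f g p : R[X]) :
    mulAux δ (f + g) p = mulAux δ f p + mulAux δ g p := by
  rw [mulAux, Polynomial.sum_add_index f g _ (by simp) (by simp [add_mul])]
  rfl

theorem mulAux_zero_left (p : R[X]) : mulAux δ 0 p = 0 := by
  simp [mulAux]

theorem mulAux_add_right (f p q : R[X]) :
    mulAux δ f (p + q) = mulAux δ f p + mulAux δ f q := by
  induction f using Polynomial.induction_on' with
  | add f g hf hg => rw [mulAux_add_left, mulAux_add_left, mulAux_add_left, hf, hg]; abel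
  | monomial i b => simp only [mulAux_monomial, iterate_map_add, mul_add]

theorem mulAux_zero_right (f : R[X]) : mulAux δ f 0 = 0 := by
  simp [mulAux, iterate_map_zero, Polynomial.sum]

theorem coeffDer_monomial (i : ℕ) (a : R) :
    coeffDer δ (monomial i a) = monomial i (δ a) := by
  simp [coeffDer, Polynomial.sum_monomial_index]

theorem coeffDer_C_mul (a : R) (p : R[X]) :
    coeffDer δ (C a * p) = C a * coeffDer δ p + C (δ a) * p := by
  induction p using Polynomial.induction_on' with
  | add p q hp hq => simp only [mul_add, map_add, hp, hq]; abel
  | monomial i b => simp [C_mul_monomial, coeffDer_monomial, mul_comm b]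

theorem thetaMul_apply (p : R[X]) : thetaMul δ p = X * p + coeffDer δ p := rfl

theorem mulAux_C_mul (a : R) (f p : R[X]) :
    mulAux δ (C a * f) p = C a * mulAux δ f p := by
  induction f using Polynomial.induction_on' with
  | add f g hf hg => rw [mul_add, mulAux_add_left, mulAux_add_left, hf, hg, mul_add]
  | monomial i b => rw [C_mul_monomial, mulAux_monomial, mulAux_monomial, C_mul, mul_assoc]

theorem mulAux_thetaMul (f p : R[X]) :
    mulAux δ (thetaMul δ f) p = thetaMul δ (mulAux δ f p) := by
  induction f using Polynomial.induction_on' with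
  | add f g hf hg => simp only [map_add, mulAux_add_left, hf, hg]
  | monomial i b =>
    rw [thetaMul_apply, X_mul_monomial, coeffDer_monomial, mulAux_add_left,
      mulAux_monomial, mulAux_monomial, mulAux_monomial, thetaMul_apply, coeffDer_C_mul,
      Function.iterate_succ_apply', thetaMul_apply]
    ring

theorem mulAux_assoc (f g p : R[X]) :
    mulAux δ (mulAux δ f g) p = mulAux δ f (mulAux δ g p) := by
  induction f using Polynomial.induction_on' with
  | add f h hf hh => simp only [mulAux_add_left, hf, hh]
  | monomial i b =>
    rw [mulAux_monomial, mulAux_monomial, mulAux_C_mul]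
    congr 1
    induction i with
    | zero => rfl
    | succ i ih =>
      rw [Function.iterate_succ_apply', Function.iterate_succ_apply', mulAux_thetaMul, ih]

theorem iterate_thetaMul_one (i : ℕ) : (thetaMul δ)^[i] (1 : R[X]) = X ^ i := by
  induction i with
  | zero => simp
  | succ i ih =>
    rw [Function.iterate_succ_apply', ih, thetaMul_apply, ← monomial_one_right_eq_X_pow,
      coeffDer_monomial]
    simp [monomial_one_right_eq_X_pow, pow_succ']

theorem mulAux_one_right (f : R[X]) : mulAux δ f 1 = f := by
  induction f using Polynomial.induction_on' with
  | add f g hf hg => rw [mulAux_add_left, hf, hg]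
  | monomial i b => rw [mulAux_monomial, iterate_thetaMul_one, C_mul_X_pow_eq_monomial]

theorem mulAux_C_left (a : R) (p : R[X]) : mulAux δ (C a) p = C a * p := by
  rw [← monomial_zero_left, mulAux_monomial, Function.iterate_zero_apply, monomial_zero_left]

/-- The ring structure of `R[θ; δ]`. -/
instance : Ring (DiffOpRing δ) where
  __ := (inferInstance : AddCommGroup (DiffOpRing δ))
  mul f g := mulAux δ f g
  one := (1 : R[X])
  left_distrib f g h := mulAux_add_right δ f g h
  right_distrib f g h := mulAux_add_left δ f g h
  zero_mul f := mulAux_zero_left δ f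
  mul_zero f := mulAux_zero_right δ f
  mul_assoc f g h := mulAux_assoc δ f g h
  one_mul f := (mulAux_C_left δ 1 f).trans (one_mul (M := R[X]) f)
  mul_one f := mulAux_one_right δ f

/-- The inclusion of the coefficient ring `R` into `R[θ; δ]`. -/
def ofCoeff : R →+* DiffOpRing δ where
  toFun a := (C a : R[X])
  map_zero' := C_0
  map_one' := C_1
  map_add' a b := C_add (a := a) (b := b)
  map_mul' a b := (C_mul (a := a) (b := b)).trans (mulAux_C_left δ a (C b)).symm

/-- The indeterminate `θ` of `R[θ; δ]`. -/
def theta : DiffOpRing δ := (X : R[X])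

/-- The defining relation `θ a = a θ + δ(a)`. -/
theorem theta_mul_ofCoeff (a : R) :
    theta δ * ofCoeff δ a = ofCoeff δ a * theta δ + ofCoeff δ (δ a) := by
  change mulAux δ X (C a) = mulAux δ (C a) X + C (δ a)
  have h : coeffDer δ (C a) = C (δ a) := coeffDer_monomial δ 0 a
  have hX : mulAux δ X (C a) = thetaMul δ (C a) := by
    rw [← monomial_one_one_eq_X, mulAux_monomial, Function.iterate_one, C_1, one_mul]
  rw [mulAux_C_left, hX, thetaMul_apply, h, mul_comm X]

/-- `a θⁱ` is the formal monomial of degree `i` with coefficient `a`; hence the powers of `θ` form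
a basis of `R[θ; δ]` as a left `R`-module. -/
theorem ofCoeff_mul_theta_pow (a : R) (i : ℕ) :
    ofCoeff δ a * theta δ ^ i = (monomial i a : R[X]) := by
  have h : ∀ n : ℕ, theta δ ^ n = (X ^ n : R[X]) := by
    intro n
    induction n with
    | zero => rw [pow_zero, pow_zero]; rfl
    | succ n ih =>
      rw [pow_succ', ih]
      change mulAux δ X (X ^ n) = _
      rw [← iterate_thetaMul_one δ n, ← iterate_thetaMul_one δ (n + 1), ← monomial_one_one_eq_X,
        mulAux_monomial, Function.iterate_one, C_1, one_mul, Function.iterate_succ_apply']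
  rw [h]
  exact (mulAux_C_left δ a _).trans (C_mul_X_pow_eq_monomial)

/-- The left ideal `Sθx` of `S = R[θ; δ]`. -/
abbrev idealThetaMul (x : R) : Submodule (DiffOpRing δ) (DiffOpRing δ) :=
  Submodule.span (DiffOpRing δ) {theta δ * ofCoeff δ x}

/-- The submodule `Sx/Sθx` of `S/Sθx`, where `S = R[θ; δ]`. -/
abbrev quotientSub (x : R) : Submodule (DiffOpRing δ) (DiffOpRing δ ⧸ idealThetaMul δ x) :=
  (Submodule.span (DiffOpRing δ) {ofCoeff δ x}).map (idealThetaMul δ x).mkQ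

end

end DiffOpRing

namespace DiffOpRing

open Polynomial

section

variable {R : Type u} [CommRing R] (δ : Derivation ℤ R R)

/-! Not Artinian: `R` is a right `S`-module with `θ` acting as `-δ`. This attaches to each ideal `I`
of `R` a left ideal of `S` meeting `R` in `I`, so the ideals of `R/P` embed in the submodules of
`S/Sθx`; descending chains would stop only if the domain `R/P` were a field. Simple: `Sx/Sθx` is
generated by the class of `x`, which `θ` kills, and `Sθ` is a maximal left ideal because `R` is
`δ`-simple. Essential: a power of `x` carries any element of `S` into `Sx`
(`exists_pow_mul_eq_mul`), and left multiplication by `x` is injective on `S/Sθx`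
(`mem_idealThetaMul_of_mul_mem`). The latter rests on `θ^(m+1) x = x θ^(m+1) + (m+1) δ(x) θ^m +
...`, read modulo `x`, where `(m+1) δ(x)` is not a zero divisor. -/

theorem induction_on {p : DiffOpRing δ → Prop} (f : DiffOpRing δ)
    (add : ∀ f g, p f → p g → p (f + g))
    (mul_theta_pow : ∀ (i : ℕ) (a : R), p (ofCoeff δ a * theta δ ^ i)) : p f := by
  refine Polynomial.induction_on' (motive := p) (f : R[X]) add fun i a => ?_
  rw [← ofCoeff_mul_theta_pow]
  exact mul_theta_pow i a

/-! ### The right action of `R[θ; δ]` on `R` -/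

/-- The action of `R[θ; δ]` on `1` in the right module `R` on which `θ` acts as `-δ`. -/
noncomputable def rightEval : DiffOpRing δ →+ R where
  toFun := fun p : R[X] => p.sum fun i a => (-1) ^ i * δ^[i] a
  map_zero' := Polynomial.sum_zero_index _
  map_add' p q := Polynomial.sum_add_index p q _ (fun i => by rw [iterate_map_zero, mul_zero])
    (fun i a b => by rw [iterate_map_add, mul_add])

theorem rightEval_ofCoeff_mul_theta_pow (a : R) (i : ℕ) :
    rightEval δ (ofCoeff δ a * theta δ ^ i) = (-1) ^ i * δ^[i] a := by
  rw [ofCoeff_mul_theta_pow]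
  refine Polynomial.sum_monomial_index a (fun i a => (-1) ^ i * δ^[i] a) ?_
  rw [iterate_map_zero, mul_zero]

theorem rightEval_ofCoeff (a : R) : rightEval δ (ofCoeff δ a) = a := by
  simpa using rightEval_ofCoeff_mul_theta_pow δ a 0

theorem rightEval_mul_theta (s : DiffOpRing δ) :
    rightEval δ (s * theta δ) = -δ (rightEval δ s) := by
  induction s using induction_on with
  | add f g hf hg => rw [add_mul, map_add, hf, hg, map_add, map_add, neg_add]
  | mul_theta_pow i a =>
    rw [mul_assoc, ← pow_succ, rightEval_ofCoeff_mul_theta_pow, rightEval_ofCoeff_mul_theta_pow,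
      Function.iterate_succ_apply']
    rcases Nat.even_or_odd i with h | h
    · simp [pow_succ, h.neg_one_pow]
    · simp [pow_succ, h.neg_one_pow]

/-- The sign in `-δ` is what makes this agree with `θ b = b θ + δ(b)`: `-δ(rb) + r δ(b) = -δ(r) b`.
-/
theorem rightEval_mul_ofCoeff (s : DiffOpRing δ) (b : R) :
    rightEval δ (s * ofCoeff δ b) = rightEval δ s * b := by
  induction s using induction_on with
  | add f g hf hg => rw [add_mul, map_add, hf, hg, map_add, add_mul]
  | mul_theta_pow i a =>
    induction i generalizing b with
    | zero => rw [pow_zero, mul_one, ← map_mul, rightEval_ofCoeff, rightEval_ofCoeff]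
    | succ i ih =>
      rw [pow_succ, ← mul_assoc, mul_assoc _ (theta δ), theta_mul_ofCoeff, mul_add, ← mul_assoc,
        map_add, rightEval_mul_theta, rightEval_mul_theta, ih, ih, Derivation.leibniz]
      simp only [smul_eq_mul]
      ring

/-- The left ideal `S I` of `S = R[θ; δ]` extended from an ideal `I` of `R`, described through the
right action of `S` on `R`. -/
noncomputable def extendIdeal (I : Ideal R) : Submodule (DiffOpRing δ) (DiffOpRing δ) where
  carrier := {s | ∀ t, rightEval δ (t * s) ∈ I}
  zero_mem' t := by simp
  add_mem' hf hg t := by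
    rw [mul_add, map_add]
    exact I.add_mem (hf t) (hg t)
  smul_mem' c s hs t := by
    rw [smul_eq_mul, ← mul_assoc]
    exact hs _

theorem ofCoeff_mem_extendIdeal {I : Ideal R} {b : R} :
    ofCoeff δ b ∈ extendIdeal δ I ↔ b ∈ I := by
  refine ⟨fun h => ?_, fun h t => ?_⟩
  · simpa [rightEval_ofCoeff] using h 1
  · rw [rightEval_mul_ofCoeff]
    exact I.mul_mem_left _ h

theorem extendIdeal_mono : Monotone (extendIdeal δ) := fun _ _ h _ hs t => h (hs t)

theorem extendIdeal_injective : Function.Injective (extendIdeal δ) := fun I J h => by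
  ext b
  rw [← ofCoeff_mem_extendIdeal δ, h, ofCoeff_mem_extendIdeal]

theorem idealThetaMul_le_extendIdeal {I : Ideal R} {x : R} (hx : x ∈ I) :
    idealThetaMul δ x ≤ extendIdeal δ I := by
  rw [Submodule.span_singleton_le_iff_mem]
  exact (extendIdeal δ I).smul_mem _ ((ofCoeff_mem_extendIdeal δ).2 hx)

theorem not_isArtinian_quotient {x : R} {P : Ideal R} (hP : P.IsPrime) (hmax : ¬ P.IsMaximal)
    (hx : x ∈ P) : ¬ IsArtinian (DiffOpRing δ) (DiffOpRing δ ⧸ idealThetaMul δ x) := by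
  intro h
  let e : Ideal (R ⧸ P) → Submodule (DiffOpRing δ) (DiffOpRing δ ⧸ idealThetaMul δ x) :=
    fun I => (extendIdeal δ (I.comap (Ideal.Quotient.mk P))).map (idealThetaMul δ x).mkQ
  -- Nothing is lost in the quotient: the preimage of `I` in `R` contains `P`, hence `x`.
  have key : ∀ I : Ideal (R ⧸ P),
      (e I).comap (idealThetaMul δ x).mkQ = extendIdeal δ (I.comap (Ideal.Quotient.mk P)) := by
    intro I
    rw [Submodule.comap_map_mkQ, sup_eq_right]
    refine idealThetaMul_le_extendIdeal δ ?_
    rw [Ideal.mem_comap, Ideal.Quotient.eq_zero_iff_mem.2 hx]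
    exact I.zero_mem
  have he : StrictMono e := by
    refine Monotone.strictMono_of_injective (fun I J hIJ => ?_) fun I J hIJ => ?_
    · exact Submodule.map_mono (extendIdeal_mono δ (Ideal.comap_mono hIJ))
    · have h1 := key I
      rw [hIJ, key J] at h1
      exact Ideal.comap_injective_of_surjective _ Ideal.Quotient.mk_surjective
        (extendIdeal_injective δ h1.symm)
  have : IsArtinianRing (R ⧸ P) := ⟨he.wellFoundedLT.wf⟩
  exact hmax (Ideal.Quotient.maximal_of_isField P (IsArtinianRing.isField_of_isDomain (R ⧸ P)))

/-! ### The left ideal `Sθ` -/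

theorem exists_eq_mul_theta_add_ofCoeff (s : DiffOpRing δ) :
    ∃ (t : DiffOpRing δ) (a : R), s = t * theta δ + ofCoeff δ a := by
  induction s using induction_on with
  | add f g hf hg =>
    obtain ⟨t, a, rfl⟩ := hf
    obtain ⟨u, b, rfl⟩ := hg
    exact ⟨t + u, a + b, by rw [add_mul, map_add]; abel⟩
  | mul_theta_pow i a =>
    cases i with
    | zero => exact ⟨0, a, by simp⟩
    | succ i => exact ⟨ofCoeff δ a * theta δ ^ i, 0, by simp [pow_succ, mul_assoc]⟩

/-- Modulo `Sθ` every element is a coefficient, so `J` is determined by `J ∩ R`. This ideal is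
`δ`-stable, since `δ(a) = θ a - a θ`. -/
theorem eq_span_theta_or_eq_top (hδ : IsDeltaSimple δ)
    (J : Submodule (DiffOpRing δ) (DiffOpRing δ)) (hJ : theta δ ∈ J) :
    J = Submodule.span (DiffOpRing δ) {theta δ} ∨ J = ⊤ := by
  have hmul : ∀ t, t * theta δ ∈ J := fun t => J.smul_mem t hJ
  let I : Ideal R :=
    { carrier := {a | ofCoeff δ a ∈ J}
      zero_mem' := by simp
      add_mem' := fun {a b} ha hb => by
        simp only [Set.mem_ofPred_eq, map_add] at *
        exact J.add_mem ha hb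
      smul_mem' := fun c a ha => by
        simp only [Set.mem_ofPred_eq, smul_eq_mul, map_mul] at *
        exact J.smul_mem _ ha }
  have hI : ∀ a, a ∈ I ↔ ofCoeff δ a ∈ J := fun a => Iff.rfl
  have hI' : ∀ a ∈ I, δ a ∈ I := by
    intro a ha
    rw [hI, ← J.add_mem_iff_right (hmul (ofCoeff δ a)), ← theta_mul_ofCoeff]
    exact J.smul_mem _ ha
  rcases hδ I hI' with h | h
  · left
    refine le_antisymm (fun s hs => ?_) ((Submodule.span_singleton_le_iff_mem _ _).2 hJ)
    obtain ⟨t, a, rfl⟩ := exists_eq_mul_theta_add_ofCoeff δ s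
    have ha : a ∈ I := (hI a).2 ((J.add_mem_iff_right (hmul t)).1 hs)
    rw [h, Ideal.mem_bot] at ha
    rw [ha, map_zero, add_zero]
    exact Submodule.smul_mem _ t (Submodule.mem_span_singleton_self _)
  · right
    have h1 : (1 : R) ∈ I := h ▸ Submodule.mem_top
    rw [hI, map_one] at h1
    exact (Submodule.eq_top_iff').2 fun s => by simpa using J.smul_mem s h1

theorem quotientSub_eq_range (x : R) :
    quotientSub δ x = LinearMap.range
      (LinearMap.toSpanSingleton (DiffOpRing δ) (DiffOpRing δ ⧸ idealThetaMul δ x)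
        ((idealThetaMul δ x).mkQ (ofCoeff δ x))) := by
  rw [quotientSub, Submodule.map_span, Set.image_singleton, LinearMap.range_toSpanSingleton]

theorem isSimpleModule_quotientSub (hδ : IsDeltaSimple δ) {x : R}
    (hx : ofCoeff δ x ∉ idealThetaMul δ x) :
    IsSimpleModule (DiffOpRing δ) (quotientSub δ x) := by
  rw [quotientSub_eq_range]
  set φ := LinearMap.toSpanSingleton (DiffOpRing δ) (DiffOpRing δ ⧸ idealThetaMul δ x)
    ((idealThetaMul δ x).mkQ (ofCoeff δ x)) with hφ
  have hθ : theta δ ∈ LinearMap.ker φ := by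
    rw [LinearMap.mem_ker, hφ, LinearMap.toSpanSingleton_apply, ← map_smul,
      Submodule.mkQ_apply, Submodule.Quotient.mk_eq_zero]
    exact Submodule.mem_span_singleton_self _
  have htop : LinearMap.ker φ ≠ ⊤ := by
    intro h
    have h1 : (1 : DiffOpRing δ) ∈ LinearMap.ker φ := h ▸ Submodule.mem_top
    rw [LinearMap.mem_ker, hφ, LinearMap.toSpanSingleton_apply, one_smul,
      Submodule.mkQ_apply, Submodule.Quotient.mk_eq_zero] at h1
    exact hx h1
  have hker := (eq_span_theta_or_eq_top δ hδ _ hθ).resolve_right htop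
  have : IsSimpleModule (DiffOpRing δ) (DiffOpRing δ ⧸ LinearMap.ker φ) := by
    rw [isSimpleModule_iff_isCoatom]
    refine ⟨htop, fun J hJ => (eq_span_theta_or_eq_top δ hδ J (hJ.le hθ)).resolve_left ?_⟩
    rw [← hker]
    exact hJ.ne'
  exact IsSimpleModule.congr φ.quotKerEquivRange.symm

/-! ### Multiplication by `x` -/

/-- Moving past one `θ` costs one factor `x`: `x^(m+1) θ = (θ x - (m+1) δ(x)) x^m`. -/
theorem exists_pow_mul_theta_pow_eq (x : R) (i m : ℕ) :
    ∃ s, ofCoeff δ x ^ (m + i) * theta δ ^ i = s * ofCoeff δ x ^ m := by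
  induction i generalizing m with
  | zero => exact ⟨1, by simp⟩
  | succ i ih =>
    obtain ⟨s, hs⟩ := ih (m + 1)
    refine ⟨s * (theta δ * ofCoeff δ x - ofCoeff δ ((m + 1 : ℕ) • δ x)), ?_⟩
    have h : ofCoeff δ x ^ (m + 1) * theta δ =
        (theta δ * ofCoeff δ x - ofCoeff δ ((m + 1 : ℕ) • δ x)) * ofCoeff δ x ^ m := by
      have h1 := theta_mul_ofCoeff δ (x ^ (m + 1))
      have h2 : δ (x ^ (m + 1)) = ((m + 1 : ℕ) • δ x) * x ^ m := by
        rw [Derivation.leibniz_pow]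
        simp only [Nat.add_sub_cancel, smul_eq_mul, nsmul_eq_mul]
        ring
      rw [h2, map_mul, map_pow, map_pow] at h1
      rw [sub_mul, mul_assoc, ← pow_succ', h1]
      abel
    rw [pow_succ (theta δ), ← mul_assoc, ← add_assoc, add_right_comm, hs, mul_assoc, h, mul_assoc]

theorem exists_pow_mul_eq_mul (x : R) (f : DiffOpRing δ) :
    ∃ (k : ℕ) (s : DiffOpRing δ), ofCoeff δ x ^ k * f = s * ofCoeff δ x := by
  induction f using induction_on with
  | add f g hf hg =>
    obtain ⟨k, s, hs⟩ := hf
    obtain ⟨l, t, ht⟩ := hg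
    refine ⟨k + l, ofCoeff δ x ^ l * s + ofCoeff δ x ^ k * t, ?_⟩
    rw [mul_add, add_mul, mul_assoc _ s, mul_assoc _ t, ← hs, ← ht, ← mul_assoc, ← mul_assoc,
      ← pow_add, ← pow_add, add_comm l k]
  | mul_theta_pow i a =>
    obtain ⟨s, hs⟩ := exists_pow_mul_theta_pow_eq δ x i 1
    refine ⟨1 + i, ofCoeff δ a * s, ?_⟩
    rw [pow_one] at hs
    rw [mul_assoc, ← hs, ← mul_assoc, ← mul_assoc, ← map_pow, ← map_mul, ← map_mul, mul_comm a]

/-! ### Coefficients modulo `x`, and injectivity of multiplication by `x` -/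

theorem coeff_coeffDer (p : R[X]) (j : ℕ) : (coeffDer δ p).coeff j = δ (p.coeff j) := by
  induction p using Polynomial.induction_on' with
  | add p q hp hq => rw [map_add, coeff_add, coeff_add, hp, hq, map_add]
  | monomial i a =>
    rw [coeffDer_monomial, coeff_monomial, coeff_monomial]
    split_ifs <;> simp

theorem coeff_iterate_thetaMul_C_of_lt (x : R) {i j : ℕ} (h : i < j) :
    ((thetaMul δ)^[i] (C x)).coeff j = 0 := by
  induction i generalizing j with
  | zero => simp [coeff_C, h.ne']
  | succ i ih =>
    obtain ⟨j, rfl⟩ := Nat.exists_eq_add_one_of_ne_zero (Nat.ne_zero_of_lt h)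
    rw [Function.iterate_succ_apply', thetaMul_apply, coeff_add, coeff_X_mul, coeff_coeffDer,
      ih (by omega), ih (by omega), map_zero, add_zero]

theorem coeff_iterate_thetaMul_C_self (x : R) (i : ℕ) :
    ((thetaMul δ)^[i] (C x)).coeff i = x := by
  induction i with
  | zero => simp
  | succ i ih =>
    rw [Function.iterate_succ_apply', thetaMul_apply, coeff_add, coeff_X_mul, coeff_coeffDer,
      ih, coeff_iterate_thetaMul_C_of_lt δ x i.lt_succ_self, map_zero, add_zero]

theorem coeff_iterate_succ_thetaMul_C (x : R) (i : ℕ) :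
    ((thetaMul δ)^[i + 1] (C x)).coeff i = (i + 1 : ℕ) * δ x := by
  induction i with
  | zero => simp [thetaMul_apply, coeff_coeffDer]
  | succ i ih =>
    rw [Function.iterate_succ_apply', thetaMul_apply, coeff_add, coeff_X_mul, coeff_coeffDer,
      ih, coeff_iterate_thetaMul_C_self]
    push_cast
    ring

theorem coeff_mulAux_eq_sum (f p : R[X]) (j N : ℕ) (hN : f.natDegree < N) :
    (mulAux δ f p).coeff j =
      ∑ i ∈ Finset.range N, f.coeff i * ((thetaMul δ)^[i] p).coeff j := by
  rw [mulAux, Polynomial.sum_over_range' _ (by simp) N hN, finsetSum_coeff]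
  simp only [coeff_C_mul]

/-- Descending induction on `m`: modulo `x` and the higher coefficients of `g`, the coefficient of
`θ^m` in `gθx` is `(m+1) g_m δ(x)`. -/
theorem dvd_coeff_of_dvd_coeff_mulAux {x : R} (g : R[X])
    (hx : ∀ (m : ℕ) (b : R), x ∣ b * ((m + 1 : ℕ) * δ x) → x ∣ b)
    (h : ∀ j, x ∣ (mulAux δ (g * X) (C x)).coeff j) (m : ℕ) : x ∣ g.coeff m := by
  suffices H : ∀ k m, g.natDegree < m + k → x ∣ g.coeff m from
    H (g.natDegree + 1) m (by omega)
  intro k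
  induction k with
  | zero => intro m hm; simp [coeff_eq_zero_of_natDegree_lt (show g.natDegree < m from hm)]
  | succ k ih =>
    intro m hm
    refine hx m _ ?_
    have hsum := h m
    -- Large enough to exceed both the degree and the index `m + 1`, whose term carries `g_m`.
    set N := (g * X).natDegree + m + 2
    rw [coeff_mulAux_eq_sum δ _ _ m N (by omega), ← Finset.add_sum_erase _ _
      (Finset.mem_range.2 (show m + 1 < N by omega)), coeff_mul_X,
      coeff_iterate_succ_thetaMul_C] at hsum
    refine (dvd_add_left (Finset.dvd_sum fun i hi => ?_)).1 hsum
    have hne := Finset.ne_of_mem_erase hi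
    -- Terms below `m` vanish, the term at `m` is a multiple of `x`, and those above `m + 1` involve
    -- coefficients of `g` already treated.
    rcases lt_trichotomy i m with him | rfl | him
    · simp [coeff_iterate_thetaMul_C_of_lt δ x him]
    · rw [coeff_iterate_thetaMul_C_self]
      exact dvd_mul_left _ _
    · obtain ⟨i, rfl⟩ := Nat.exists_eq_add_one_of_ne_zero (Nat.ne_zero_of_lt him)
      rw [coeff_mul_X]
      exact (ih i (by omega)).mul_right _

theorem mulAux_X_right (g : R[X]) : mulAux δ g X = g * X := by
  induction g using Polynomial.induction_on' with
  | add f g hf hg => rw [mulAux_add_left, hf, hg, add_mul]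
  | monomial i a =>
    rw [mulAux_monomial, ← pow_one X, ← iterate_thetaMul_one δ 1, ← Function.iterate_add_apply,
      iterate_thetaMul_one, iterate_thetaMul_one, pow_add, ← mul_assoc, C_mul_X_pow_eq_monomial]

theorem eq_mulAux_of_mulAux_eq_C_mul [IsDomain R] {x : R} (hx0 : x ≠ 0)
    (hx : ∀ (m : ℕ) (b : R), x ∣ b * ((m + 1 : ℕ) * δ x) → x ∣ b) {f g : R[X]}
    (h : mulAux δ g (mulAux δ X (C x)) = C x * f) :
    ∃ g', mulAux δ g' (mulAux δ X (C x)) = f := by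
  have hdvd : C x ∣ g := by
    rw [C_dvd_iff_dvd_coeff]
    refine dvd_coeff_of_dvd_coeff_mulAux δ g hx fun j => ?_
    rw [← mulAux_X_right δ, mulAux_assoc, h, coeff_C_mul]
    exact dvd_mul_right _ _
  obtain ⟨g', rfl⟩ := hdvd
  rw [mulAux_C_mul] at h
  exact ⟨g', mul_left_cancel₀ (C_ne_zero.2 hx0) h⟩

theorem mem_idealThetaMul_of_mul_mem [IsDomain R] {x : R} (hx0 : x ≠ 0)
    (hx : ∀ (m : ℕ) (b : R), x ∣ b * ((m + 1 : ℕ) * δ x) → x ∣ b) {f : DiffOpRing δ}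
    (hf : ofCoeff δ x * f ∈ idealThetaMul δ x) : f ∈ idealThetaMul δ x := by
  obtain ⟨g, hg⟩ := Submodule.mem_span_singleton.1 hf
  exact Submodule.mem_span_singleton.2
    (eq_mulAux_of_mulAux_eq_C_mul δ hx0 hx (hg.trans (mulAux_C_left δ x f)))

/-! ### Essentiality -/

theorem isEssentialExtension_quotientSub {x : R}
    (hx : ∀ f, ofCoeff δ x * f ∈ idealThetaMul δ x → f ∈ idealThetaMul δ x) :
    IsEssentialExtension (quotientSub δ x) := by
  intro U hU
  obtain ⟨u, hu, hu0⟩ := Submodule.exists_mem_ne_zero_of_ne_bot hU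
  obtain ⟨f, rfl⟩ := (idealThetaMul δ x).mkQ_surjective u
  obtain ⟨k, s, hs⟩ := exists_pow_mul_eq_mul δ x f
  have hpow : ∀ n : ℕ, ofCoeff δ x ^ n * f ∉ idealThetaMul δ x := by
    intro n
    induction n with
    | zero =>
      rw [pow_zero, one_mul]
      rwa [Submodule.mkQ_apply, ne_eq, Submodule.Quotient.mk_eq_zero] at hu0
    | succ n ih =>
      rw [pow_succ', mul_assoc]
      exact fun h => ih (hx _ h)
  refine (Submodule.ne_bot_iff _).2 ⟨(idealThetaMul δ x).mkQ (ofCoeff δ x ^ k * f), ⟨?_, ?_⟩, ?_⟩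
  · rw [← smul_eq_mul, map_smul]
    exact U.smul_mem _ hu
  · rw [hs]
    exact Submodule.mem_map_of_mem
      (Submodule.smul_mem _ s (Submodule.mem_span_singleton_self _))
  · rw [Submodule.mkQ_apply, ne_eq, Submodule.Quotient.mk_eq_zero]
    exact hpow k

end

end DiffOpRing

/-- In a `δ`-simple ring a non-zero non-unit does not divide its derivative. -/
theorem IsDeltaSimple.not_dvd_derivation {R : Type*} [CommRing R] {δ : Derivation ℤ R R}
    (hδ : IsDeltaSimple δ) {x : R} (hx0 : x ≠ 0) (hx : ¬ IsUnit x) : ¬ x ∣ δ x := by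
  intro h
  have hI : ∀ a ∈ Ideal.span {x}, δ a ∈ Ideal.span {x} := by
    intro a ha
    rw [Ideal.mem_span_singleton] at ha ⊢
    obtain ⟨c, rfl⟩ := ha
    rw [Derivation.leibniz, smul_eq_mul, smul_eq_mul]
    exact dvd_add (dvd_mul_right _ _) (h.mul_left _)
  rcases hδ _ hI with h | h
  · exact hx0 (Ideal.span_singleton_eq_bot.1 h)
  · exact hx (Ideal.span_singleton_eq_top.1 h)

theorem mainTheorem3 {K : Type*} {R : Type*} [Field K] [CharZero K] [CommRing R] [IsDomain R]
    [IsNoetherianRing R] [Algebra K R] (δ : Derivation ℤ R R) (hδ : IsDeltaSimple δ)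
    (x : R) (hxP : ∃ P : Ideal R, P.IsPrime ∧ ¬ P.IsMaximal ∧ x ∈ P)
    (hx : IsUnit (δ x) ∨ Prime x) :
    IsSimpleModule (DiffOpRing δ) (DiffOpRing.quotientSub δ x) ∧
      IsEssentialExtension (DiffOpRing.quotientSub δ x) ∧
      ¬ IsArtinian (DiffOpRing δ) (DiffOpRing δ ⧸ DiffOpRing.idealThetaMul δ x) ∧
      ¬ SatisfiesDiamond (DiffOpRing δ) := by
  obtain ⟨P, hP, hmax, hxP⟩ := hxP
  have hx0 : x ≠ 0 := by
    rintro rfl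
    rcases hx with h | h
    · simp at h
    · exact h.ne_zero rfl
  have hxu : ¬ IsUnit x := fun h => hP.ne_top (P.eq_top_of_isUnit_mem hxP h)
  have hdvd : ∀ (m : ℕ) (b : R), x ∣ b * ((m + 1 : ℕ) * δ x) → x ∣ b := by
    intro m b h
    -- Characteristic zero enters here: positive integers are invertible in `K`.
    have hm : IsUnit ((m + 1 : ℕ) : R) := by
      rw [← map_natCast (algebraMap K R)]
      exact (IsUnit.mk0 _ (Nat.cast_ne_zero.2 m.succ_ne_zero)).map _
    rw [mul_left_comm, hm.dvd_mul_left] at h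
    rcases hx with hu | hp
    · exact hu.dvd_mul_right.1 h
    · exact (hp.dvd_or_dvd h).resolve_right (hδ.not_dvd_derivation hx0 hxu)
  have hmem : ∀ f, DiffOpRing.ofCoeff δ x * f ∈ DiffOpRing.idealThetaMul δ x →
      f ∈ DiffOpRing.idealThetaMul δ x :=
    fun f => DiffOpRing.mem_idealThetaMul_of_mul_mem δ hx0 hdvd
  have hxmem : DiffOpRing.ofCoeff δ x ∉ DiffOpRing.idealThetaMul δ x := by
    intro h
    -- Cancelling `x` would put `1` in `Sθx`, hence in `P`.
    have h1 : DiffOpRing.ofCoeff δ 1 ∈ DiffOpRing.idealThetaMul δ x :=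
      hmem _ (by rwa [map_one, mul_one])
    exact (Ideal.ne_top_iff_one P).1 hP.ne_top ((DiffOpRing.ofCoeff_mem_extendIdeal δ).1
      (DiffOpRing.idealThetaMul_le_extendIdeal δ hxP h1))
  have hsimple := DiffOpRing.isSimpleModule_quotientSub δ hδ hxmem
  have hess := DiffOpRing.isEssentialExtension_quotientSub δ hmem
  have hart := DiffOpRing.not_isArtinian_quotient δ hP hmax hxP
  refine ⟨hsimple, hess, hart, fun h => hart (h _ _ ⟨Submodule.Quotient.mk 1, ?_⟩ hsimple hess)⟩
  refine Submodule.eq_top_iff'.2 fun u => ?_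
  obtain ⟨s, rfl⟩ := Submodule.Quotient.mk_surjective _ u
  refine Submodule.mem_span_singleton.2 ⟨s, ?_⟩
  rw [← Submodule.Quotient.mk_smul, smul_eq_mul, mul_one]
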